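/- Let $\sigma(x)=1/(1+e^{-x})$. For a real $m\times n$ matrix $B$ (with $m,n\ge 1$) let $\|B\|_*$ be the nuclear norm (sum of singular values) and $\|B\|_{\max}=\max_{u,i}|B_{u,i}|$. There is a universal constant $C>0$ such that the following holds for all $m,n$ with $m+n\ge C$. Let $\theta,\alpha,\phi\in(0,\infty)$, $\tau\ge\theta$, $\gamma\ge\alpha$, $\psi\ge\phi$ and $\delta\in(0,1)$. Let $A,X^*,\widehat S\in\mathbb R^{m\times n}$ be fixed (non-random) matrices with $\|A\|_*\le\theta\sqrt{mn}$, $\|A\|_{\max}\le\alpha$, $\|X^*\|_{\max}\le\phi$ and $\|\widehat S\|_{\max}\le\psi$, and let $P_{u,i}=\sigma(A_{u,i})$. The partially observed matrix $X$ is generated by setting, independently for each entry, $X_{u,i}=X^*_{u,i}$ with probability $P_{u,i}$ and $X_{u,i}=\star$ (missing) otherwise; let $\Omega$ be the set of revealed entries and $M_{u,i}=\mathbf 1\{(u,i)\in\Omega\}$. The algorithm 1bitMC computes $$\widehat A\in\operatorname*{arg\,max}_{\Gamma\in\mathbb R^{m\times n}:\ \|\Gamma\|_*\le\tau\sqrt{mn},\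 \|\Gamma\|_{\max}\le\gamma}\ \sum_{u=1}^m\sum_{i=1}^n\big[M_{u,i}\log\sigma(\Gamma_{u,i})+(1-M_{u,i})\log(1-\sigma(\Gamma_{u,i}))\big],\qquad \widehat P_{u,i}=\sigma(\widehat A_{u,i}).$$ Define $$L_{\text{full MSE}}(\widehat S)=\frac1{mn}\sum_{u,i}(\widehat S_{u,i}-X^*_{u,i})^2,\qquad L_{\text{IPS-MSE}}(\widehat S|\widehat P)=\frac1{mn}\sum_{(u,i)\in\Omega}\frac{(\widehat S_{u,i}-X_{u,i})^2}{\widehat P_{u,i}},$$ and $L_{\text{full MAE}}$, $L_{\text{IPS-MAE}}$ in the same way with absolute values in place of squares. Then, over the randomness in which entries are revealed: (a) with probability at least $1-\frac{C}{m+n}-\delta$, simultaneously $$\frac1{mn}\sum_{u,i}(\widehat P_{u,i}-P_{u,i})^2\le 4e\tau\Big(\frac1{\sqrt m}+\frac1{\sqrt n}\Big)$$ and $$|L_{\text{IPS-MSE}}(\widehat S|\widehat P)-L_{\text{full MSE}}(\widehat S)|\le\frac{8\psi^2\sqrt{e\tau}}{\sigma(-\gamma)\sigma(-\alpha)}\Big(\frac1{m^{1/4}}+\frac1{n^{1/4}}\Big)+\frac{4\psi^2}{\sigma(-\alpha)}\sqrt{\frac1{2mn}\log\frac2\delta};$$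 (b) (MAE version) with probability at least $1-\frac{C}{m+n}-\delta$, simultaneously the first inequality of (a) holds and $$|L_{\text{IPS-MAE}}(\widehat S|\widehat P)-L_{\text{full MAE}}(\widehat S)|\le\frac{4\psi\sqrt{e\tau}}{\sigma(-\gamma)\sigma(-\alpha)}\Big(\frac1{m^{1/4}}+\frac1{n^{1/4}}\Big)+\frac{2\psi}{\sigma(-\alpha)}\sqrt{\frac1{2mn}\log\frac2\delta}.$$ -/

import Mathlib

namespace OneBitMC

noncomputable section

open MeasureTheory ProbabilityTheory

/-- The nuclear norm `‖A‖_*` of a real `m × n` matrix: the sum of its singular values (for the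
Euclidean inner products), counted with multiplicity. -/
def nuclearNorm {m n : ℕ} (A : Matrix (Fin m) (Fin n) ℝ) : ℝ :=
  ∑ k ∈ Finset.range n, (Matrix.toEuclideanLin A).singularValues k

/-- The entrywise maximum norm `‖A‖_max = max_{u,i} |A_{u,i}|`. -/
def maxNorm {m n : ℕ} (A : Matrix (Fin m) (Fin n) ℝ) : ℝ :=
  ⨆ p : Fin m × Fin n, |A p.1 p.2|

/-- The set `Ω` of revealed positions of a partially observed matrix; the value `none` stands for
a missing entry. -/
def revealed {m n : ℕ} (X : Matrix (Fin m) (Fin n) (Option ℝ)) : Finset (Fin m × Fin n) :=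
  Finset.univ.filter fun p => (X p.1 p.2).isSome

/-- The 0/1 missingness mask `M` of a partially observed matrix: `1` where the entry is revealed. -/
def mask {m n : ℕ} (X : Matrix (Fin m) (Fin n) (Option ℝ)) : Matrix (Fin m) (Fin n) ℝ :=
  Matrix.of fun u i => if (X u i).isSome then 1 else 0

/-- The random matrix `X` is obtained from the full data matrix `Xstar` by revealing each entry
`(u, i)`, independently of all the others, with probability `P u i`. -/
structure IsPartialObservation {Ω : Type*} [MeasurableSpace Ω] (μ : Measure Ω) {m n : ℕ}
    (Xstar P : Matrix (Fin m) (Fin n) ℝ) (X : Ω → Matrix (Fin m) (Fin n) (Option ℝ)) : Prop where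
  eq_some_or_none : ∀ ω u i, X ω u i = some (Xstar u i) ∨ X ω u i = none
  measurableSet_revealed : ∀ u i, MeasurableSet {ω | (X ω u i).isSome}
  prob_revealed : ∀ u i, μ {ω | (X ω u i).isSome} = ENNReal.ofReal (P u i)
  indep : iIndepSet (fun p : Fin m × Fin n => {ω | (X ω p.1 p.2).isSome}) μ

/-- The Bernoulli log-likelihood of the mask `M` at the parameter matrix `Γ`, with the standard
logistic link function. -/
def logLikelihood {m n : ℕ} (M Γ : Matrix (Fin m) (Fin n) ℝ) : ℝ :=
  ∑ u, ∑ i, (M u i * Real.log (Real.sigmoid (Γ u i))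
    + (1 - M u i) * Real.log (1 - Real.sigmoid (Γ u i)))

/-- The feasible set of 1bitMC. -/
def feasibleSet (m n : ℕ) (τ γ : ℝ) : Set (Matrix (Fin m) (Fin n) ℝ) :=
  {Γ | nuclearNorm Γ ≤ τ * √((m : ℝ) * n) ∧ maxNorm Γ ≤ γ}

/-- `Phat` is the output of 1bitMC with parameters `τ, γ` on the mask `M`: it is the entrywise
logistic image of a maximizer of the log-likelihood over the feasible set. -/
def IsOutput {m n : ℕ} (τ γ : ℝ) (M Phat : Matrix (Fin m) (Fin n) ℝ) : Prop :=
  ∃ Ahat ∈ feasibleSet m n τ γ, IsMaxOn (logLikelihood M) (feasibleSet m n τ γ) Ahat ∧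
    Phat = Ahat.map Real.sigmoid

/-- The mean squared difference of two matrices; `mse Shat Xstar` is the full MSE loss. -/
def mse {m n : ℕ} (S T : Matrix (Fin m) (Fin n) ℝ) : ℝ :=
  1 / ((m : ℝ) * n) * ∑ u, ∑ i, (S u i - T u i) ^ 2

/-- The mean absolute difference of two matrices; `mae Shat Xstar` is the full MAE loss. -/
def mae {m n : ℕ} (S T : Matrix (Fin m) (Fin n) ℝ) : ℝ :=
  1 / ((m : ℝ) * n) * ∑ u, ∑ i, |S u i - T u i|

/-- The inverse-propensity-scored squared error loss of `S`, for propensities `P`. The default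
value in `getD` is never used, since the sum is over revealed entries. -/
def ipsMSE {m n : ℕ} (X : Matrix (Fin m) (Fin n) (Option ℝ)) (S P : Matrix (Fin m) (Fin n) ℝ) :
    ℝ :=
  1 / ((m : ℝ) * n) *
    ∑ p ∈ revealed X, (S p.1 p.2 - (X p.1 p.2).getD 0) ^ 2 / P p.1 p.2

/-- The inverse-propensity-scored absolute error loss of `S`, for propensities `P`. -/
def ipsMAE {m n : ℕ} (X : Matrix (Fin m) (Fin n) (Option ℝ)) (S P : Matrix (Fin m) (Fin n) ℝ) :
    ℝ :=
  1 / ((m : ℝ) * n) *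
    ∑ p ∈ revealed X, |S p.1 p.2 - (X p.1 p.2).getD 0| / P p.1 p.2

end

end OneBitMC

/-! Write P = σ(A) and M for the mask. Since log σ(x) - log(1 - σ(x)) = x, replacing M by its mean P
changes the log-likelihood at Γ only by a term linear in Γ. As A is feasible, maximality of Â and
Pinsker's inequality give 2‖P̂ - P‖_F² ≤ ⟨M - P, Â - A⟩ (`sum_sq_sigmoid_sub_le`). Because Â depends
on M, the right side needs a uniform bound: by trace duality (`sum_mul_le_mul_nuclearNorm`) it is at
most ‖M - P‖_op (‖Â‖_* + ‖A‖_*). Hoeffding's inequality over a product of 1/2-nets gives ‖M - P‖_op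
≤ 4e(√m + √n) outside an event of probability at most 1/(m + n).

The IPS error splits (`abs_sum_ips_sub_le`) into a propensity-estimation part, controlled by the
bound above and Cauchy–Schwarz, and a centred sum with non-random weights, controlled by Hoeffding.
This works for any fixed entrywise loss in [0, K] (`IsPartialObservation.le_measureReal_ips_bound`);
the squared and absolute losses are two instances. -/

namespace OneBitMC

open MeasureTheory ProbabilityTheory Module

/-! ### Nets and norms of bilinear forms -/

/-- The closed unit ball of a finite-dimensional normed space has a `1/2`-net of cardinality at
most `5 ^ dim`. -/
theorem exists_half_net (E : Type*) [NormedAddCommGroup E] [NormedSpace ℝ E]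
    [FiniteDimensional ℝ E] :
    ∃ s : Finset E, s.card ≤ 5 ^ finrank ℝ E ∧ (∀ c ∈ s, ‖c‖ ≤ 1) ∧
      ∀ x : E, ‖x‖ ≤ 1 → ∃ c ∈ s, ‖x - c‖ ≤ 1 / 2 := by
  classical
  -- A largest 1-separated subset of the ball of radius 2, scaled by 1/2, is the net; volume
  -- comparison gives the bound 5 ^ dim.
  let Q : Finset E → Prop := fun s =>
    (∀ c ∈ s, ‖c‖ ≤ 2) ∧ ∀ c ∈ s, ∀ d ∈ s, c ≠ d → 1 ≤ ‖c - d‖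
  have hbound : ∀ s, Q s → s.card ≤ 5 ^ finrank ℝ E := fun s hs =>
    Besicovitch.card_le_of_separated s hs.1 hs.2
  have h0 : ∃ s, Q s ∧ s.card = 0 := ⟨∅, by simp [Q], rfl⟩
  obtain ⟨s, hs, hcard⟩ := Nat.findGreatest_spec (P := fun k => ∃ s, Q s ∧ s.card = k)
    (Nat.zero_le (5 ^ finrank ℝ E)) h0
  refine ⟨s.image fun c => (1 / 2 : ℝ) • c, Finset.card_image_le.trans (hbound s hs), ?_, ?_⟩
  · intro c hc
    obtain ⟨d, hd, rfl⟩ := Finset.mem_image.1 hc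
    have := hs.1 d hd
    rw [norm_smul, Real.norm_of_nonneg (by norm_num)]
    linarith
  intro x hx
  by_contra! hcon
  have hfar : ∀ c ∈ s, 1 ≤ ‖(2 : ℝ) • x - c‖ := by
    intro c hc
    have h := hcon _ (Finset.mem_image_of_mem _ hc)
    have h2 : (2 : ℝ) • x - c = (2 : ℝ) • (x - (1 / 2 : ℝ) • c) := by
      rw [smul_sub, smul_smul]; norm_num
    rw [h2, norm_smul, Real.norm_ofNat]
    linarith
  have hnot : (2 : ℝ) • x ∉ s := fun h => by
    have := hfar _ h
    simp at this
    linarith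
  have hQ : Q (insert ((2 : ℝ) • x) s) := by
    constructor
    · intro c hc
      rcases Finset.mem_insert.1 hc with rfl | hc
      · rw [norm_smul, Real.norm_ofNat]; linarith
      · exact hs.1 c hc
    · intro c hc d hd hcd
      rcases Finset.mem_insert.1 hc with rfl | hc <;> rcases Finset.mem_insert.1 hd with rfl | hd
      · exact absurd rfl hcd
      · exact hfar d hd
      · rw [norm_sub_rev]; exact hfar c hc
      · exact hs.2 c hc d hd hcd
  have hle := Nat.le_findGreatest (P := fun k => ∃ s, Q s ∧ s.card = k)
    (hbound _ hQ) ⟨_, hQ, rfl⟩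
  rw [← hcard, Finset.card_insert_of_notMem hnot] at hle
  omega

/-- A linear functional bounded above by `t` on a `1/2`-net of the unit ball has norm at most
`2 t`. -/
theorem le_two_mul_of_half_net {E : Type*} [NormedAddCommGroup E] [NormedSpace ℝ E]
    [FiniteDimensional ℝ E] {s : Finset E}
    (hs : ∀ x : E, ‖x‖ ≤ 1 → ∃ c ∈ s, ‖x - c‖ ≤ 1 / 2) (L : E →ₗ[ℝ] ℝ) {t : ℝ}
    (ht : ∀ c ∈ s, L c ≤ t) (x : E) : L x ≤ 2 * t * ‖x‖ := by
  have : ProperSpace E := FiniteDimensional.proper ℝ E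
  have hcont : Continuous L := L.continuous_of_finiteDimensional
  obtain ⟨x₀, hx₀, hmax⟩ := (isCompact_closedBall (0 : E) 1).exists_isMaxOn
    ⟨0, by simp⟩ hcont.continuousOn
  have hball : ∀ y : E, ‖y‖ ≤ 1 → L y ≤ L x₀ := fun y hy => hmax (by simpa using hy)
  obtain ⟨c, hc, hxc⟩ := hs x₀ (by simpa using hx₀)
  -- The doubled remainder 2(x₀ - c) is again in the unit ball, so the maximum L x₀ absorbs half of
  -- itself.
  have h1 : L ((2 : ℝ) • (x₀ - c)) ≤ L x₀ := hball _ (by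
    rw [norm_smul, Real.norm_ofNat]; linarith)
  rw [map_smul, map_sub, smul_eq_mul] at h1
  have h2 : L x₀ ≤ 2 * t := by linarith [ht c hc]
  rcases eq_or_ne x 0 with rfl | hx
  · simp
  · have hpos : 0 < ‖x‖ := norm_pos_iff.2 hx
    have h3 := hball (‖x‖⁻¹ • x) (by rw [norm_smul, norm_inv, norm_norm, inv_mul_cancel₀ hpos.ne'])
    rw [map_smul, smul_eq_mul] at h3
    calc L x = ‖x‖⁻¹ * L x * ‖x‖ := by field_simp
      _ ≤ 2 * t * ‖x‖ := mul_le_mul_of_nonneg_right (h3.trans h2) hpos.le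

/-- A bilinear form bounded above by `t` on a product of `1/2`-nets has norm at most `4 t`. -/
theorem bilin_le_of_half_net {E F : Type*} [NormedAddCommGroup E] [NormedSpace ℝ E]
    [FiniteDimensional ℝ E] [NormedAddCommGroup F] [NormedSpace ℝ F] [FiniteDimensional ℝ F]
    {s : Finset E} {s' : Finset F}
    (hs : ∀ x : E, ‖x‖ ≤ 1 → ∃ c ∈ s, ‖x - c‖ ≤ 1 / 2)
    (hs' : ∀ x : F, ‖x‖ ≤ 1 → ∃ c ∈ s', ‖x - c‖ ≤ 1 / 2)
    (B : E →ₗ[ℝ] F →ₗ[ℝ] ℝ) {t : ℝ} (ht : ∀ c ∈ s, ∀ d ∈ s', B c d ≤ t) (x : E) (y : F) :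
    B x y ≤ 4 * t * ‖x‖ * ‖y‖ := by
  have h := le_two_mul_of_half_net hs (B.flip y)
    (fun c hc => le_two_mul_of_half_net hs' (B c) (ht c hc) y) x
  rw [LinearMap.flip_apply] at h
  linarith

/-! ### Trace duality -/

/-- ‖T b‖² = ⟨b, T*T b⟩ is the eigenvalue of T*T at b. In this basis a trace against T can be
bounded term by term by singular values. -/
theorem norm_apply_eigenvectorBasis {E F : Type*} [NormedAddCommGroup E] [InnerProductSpace ℝ E]
    [FiniteDimensional ℝ E] [NormedAddCommGroup F] [InnerProductSpace ℝ F]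
    [FiniteDimensional ℝ F] (T : E →ₗ[ℝ] F) {n : ℕ} (hn : finrank ℝ E = n) (k : Fin n) :
    ‖T (T.isSymmetric_adjoint_comp_self.eigenvectorBasis hn k)‖ = T.singularValues k := by
  set b := T.isSymmetric_adjoint_comp_self.eigenvectorBasis hn with hb
  have h1 : ‖T (b k)‖ ^ 2 = T.singularValues k ^ 2 := by
    rw [T.sq_singularValues_fin hn, ← real_inner_self_eq_norm_sq, ← LinearMap.adjoint_inner_right]
    have := T.isSymmetric_adjoint_comp_self.apply_eigenvectorBasis hn k
    rw [LinearMap.comp_apply] at this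
    rw [hb, this, inner_smul_right, real_inner_self_eq_norm_sq,
      OrthonormalBasis.norm_eq_one]
    simp
  exact (sq_eq_sq₀ (norm_nonneg _) (T.singularValues_nonneg _)).1 h1

/-- Duality of the operator norm and the nuclear norm. -/
theorem sum_mul_le_mul_nuclearNorm {m n : ℕ} (W G : Matrix (Fin m) (Fin n) ℝ) {c : ℝ}
    (hW : ∀ (x : EuclideanSpace ℝ (Fin m)) (y : EuclideanSpace ℝ (Fin n)),
      inner ℝ x (Matrix.toEuclideanLin W y) ≤ c * ‖x‖ * ‖y‖) :
    ∑ u, ∑ i, W u i * G u i ≤ c * nuclearNorm G := by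
  set T := Matrix.toEuclideanLin G with hT
  set V := Matrix.toEuclideanLin W with hV
  have hn : finrank ℝ (EuclideanSpace ℝ (Fin n)) = n := by simp
  set b := T.isSymmetric_adjoint_comp_self.eigenvectorBasis hn with hb
  -- Both sides are the trace of V*T, computed in the eigenbasis of T*T and in the standard basis.
  have h1 : ∑ k, inner ℝ (b k) ((LinearMap.adjoint V ∘ₗ T) (b k))
      = ∑ u, ∑ i, W u i * G u i := by
    rw [← LinearMap.trace_eq_sum_inner,
      LinearMap.trace_eq_sum_inner _ (EuclideanSpace.basisFun (Fin n) ℝ), Finset.sum_comm]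
    refine Finset.sum_congr rfl fun i _ => ?_
    rw [LinearMap.comp_apply, LinearMap.adjoint_inner_right, PiLp.inner_apply]
    refine Finset.sum_congr rfl fun u _ => ?_
    simp [hT, hV, Matrix.toLpLin_apply, mul_comm]
  rw [← h1, nuclearNorm, Finset.mul_sum, Finset.sum_range]
  refine Finset.sum_le_sum fun k _ => ?_
  rw [LinearMap.comp_apply, LinearMap.adjoint_inner_right, real_inner_comm]
  refine (hW _ _).trans_eq ?_
  rw [OrthonormalBasis.norm_eq_one, norm_apply_eigenvectorBasis, mul_one]

/-! ### Logistic likelihood and Pinsker's inequality -/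

theorem hasDerivAt_log_sigmoid (x : ℝ) :
    HasDerivAt (fun x => Real.log (Real.sigmoid x)) (1 - Real.sigmoid x) x := by
  convert! (Real.hasDerivAt_sigmoid x).log (Real.sigmoid_pos x).ne' using 1
  field_simp [(Real.sigmoid_pos x).ne']

theorem hasDerivAt_log_one_sub_sigmoid (x : ℝ) :
    HasDerivAt (fun x => Real.log (1 - Real.sigmoid x)) (-Real.sigmoid x) x := by
  have h : (1 - Real.sigmoid x) ≠ 0 := (sub_pos.2 (Real.sigmoid_lt_one x)).ne'
  convert! ((Real.hasDerivAt_sigmoid x).const_sub 1).log h using 1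
  field_simp

theorem log_sigmoid_sub (x : ℝ) :
    Real.log (Real.sigmoid x) - Real.log (1 - Real.sigmoid x) = x := by
  rw [← Real.sigmoid_neg, ← Real.sigmoid_mul_rexp_neg, Real.log_mul (Real.sigmoid_pos x).ne'
    (Real.exp_pos _).ne', Real.log_exp]
  ring

theorem sigmoid_mul_one_sub_le (x : ℝ) : Real.sigmoid x * (1 - Real.sigmoid x) ≤ 1 / 4 := by
  nlinarith [sq_nonneg (Real.sigmoid x - 1 / 2)]

/-- Pinsker's inequality for Bernoulli distributions, in the logistic parametrization. -/
theorem two_mul_sq_sigmoid_sub_le (a b : ℝ) :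
    2 * (Real.sigmoid b - Real.sigmoid a) ^ 2 ≤
      (Real.sigmoid a * Real.log (Real.sigmoid a)
        + (1 - Real.sigmoid a) * Real.log (1 - Real.sigmoid a))
      - (Real.sigmoid a * Real.log (Real.sigmoid b)
        + (1 - Real.sigmoid a) * Real.log (1 - Real.sigmoid b)) := by
  set p := Real.sigmoid a with hp
  -- Cross-entropy minus the quadratic. Its derivative has the sign of σ(x) - p because σ(1 - σ) ≤
  -- 1/4, so it is minimal at x = a.
  let h : ℝ → ℝ := fun x => -(p * Real.log (Real.sigmoid x)
    + (1 - p) * Real.log (1 - Real.sigmoid x)) - 2 * (Real.sigmoid x - p) ^ 2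
  have hd : ∀ x, HasDerivAt h ((Real.sigmoid x - p)
      * (1 - 4 * (Real.sigmoid x * (1 - Real.sigmoid x)))) x := by
    intro x
    convert! (((hasDerivAt_log_sigmoid x).const_mul p).add
      ((hasDerivAt_log_one_sub_sigmoid x).const_mul (1 - p))).neg.sub
      ((((Real.hasDerivAt_sigmoid x).sub_const p).pow 2).const_mul 2) using 1
    push_cast
    ring
  have hc : Continuous h := continuous_iff_continuousAt.2 fun x => (hd x).continuousAt
  have hfac : ∀ x, 0 ≤ 1 - 4 * (Real.sigmoid x * (1 - Real.sigmoid x)) := fun x => by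
    linarith [sigmoid_mul_one_sub_le x]
  have key : h a ≤ h b := by
    rcases le_total a b with hab | hab
    · refine monotoneOn_of_deriv_nonneg (convex_Ici a) hc.continuousOn
        (fun x _ => (hd x).differentiableAt.differentiableWithinAt) ?_ Set.self_mem_Ici hab hab
      intro x hx
      rw [interior_Ici] at hx
      rw [(hd x).deriv]
      exact mul_nonneg (sub_nonneg.2 (Real.sigmoid_le (le_of_lt hx))) (hfac x)
    · refine antitoneOn_of_deriv_nonpos (convex_Iic a) hc.continuousOn
        (fun x _ => (hd x).differentiableAt.differentiableWithinAt) ?_ hab Set.self_mem_Iic hab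
      intro x hx
      rw [interior_Iic] at hx
      rw [(hd x).deriv]
      exact mul_nonpos_of_nonpos_of_nonneg (sub_nonpos.2 (Real.sigmoid_le (le_of_lt hx))) (hfac x)
  simp only [h] at key
  rw [← hp] at key
  simp only [sub_self] at key
  linarith

/-! ### Concentration of the centred mask -/

/-- Hoeffding's inequality for a weighted sum of centred indicators of independent events. -/
theorem hoeffding_indicator {Ω ι : Type*} [MeasurableSpace Ω] [Fintype ι] {μ : Measure Ω}
    [IsProbabilityMeasure μ] {S : ι → Set Ω} (hS : ∀ i, MeasurableSet (S i))
    (hind : iIndepSet S μ) (w : ι → ℝ) {V ε : ℝ} (hV : ∑ i, w i ^ 2 ≤ V) (hV0 : 0 < V)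
    (hε : 0 ≤ ε) :
    μ.real {ω | ε ≤ ∑ i, w i * ((S i).indicator (fun _ => 1) ω - μ.real (S i))}
      ≤ Real.exp (-2 * ε ^ 2 / V) := by
  -- Hoeffding's lemma: a variable with values in [0, 1] has variance proxy (1/2)².
  have hsub : ∀ i, HasSubgaussianMGF
      (fun ω => (S i).indicator (fun _ => (1 : ℝ)) ω - μ.real (S i)) (1 / 4) μ := by
    intro i
    have h := hasSubgaussianMGF_of_mem_Icc (μ := μ) (X := (S i).indicator fun _ => (1 : ℝ))
      (a := 0) (b := 1) ((measurable_const.indicator (hS i)).aemeasurable)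
      (Filter.Eventually.of_forall fun ω => by
        by_cases hω : ω ∈ S i <;> simp [hω])
    rw [integral_indicator_const _ (hS i)] at h
    convert! h using 1
    · simp
    · ext; norm_num
  have hind' := hind.iIndepFun_indicator (β := ℝ) (m := inferInstance)
  have hind'' := hind'.comp (fun i x => w i * (x - μ.real (S i))) (fun i => by fun_prop)
  have hsum := HasSubgaussianMGF.sum_of_iIndepFun hind'' (s := Finset.univ)
    (fun i _ => (hsub i).const_mul (w i))
  -- Minimizer of the Chernoff exponent -tε + Vt²/8.
  set t := 4 * ε / V with ht
  have hch := measure_ge_le_exp_mul_mgf (X := fun ω => ∑ i, w i *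
    ((S i).indicator (fun _ => (1 : ℝ)) ω - μ.real (S i))) ε (by positivity : 0 ≤ t)
    (hsum.integrable_exp_mul t)
  refine hch.trans ((mul_le_mul_of_nonneg_left (hsum.mgf_le t) (Real.exp_pos _).le).trans ?_)
  rw [← Real.exp_add, Real.exp_le_exp]
  have hcoe : ((∑ i, (⟨w i ^ 2, sq_nonneg (w i)⟩ * (1 / 4) : NNReal) : NNReal) : ℝ)
      = (∑ i, w i ^ 2) / 4 := by
    rw [NNReal.coe_sum, Finset.sum_div]
    refine Finset.sum_congr rfl fun i _ => ?_
    change w i ^ 2 * ((1 / 4 : NNReal) : ℝ) = _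
    norm_num
    ring
  rw [hcoe]
  have : (∑ i, w i ^ 2) / 4 * t ^ 2 / 2 ≤ V / 4 * t ^ 2 / 2 := by gcongr
  refine (add_le_add_right this _).trans_eq ?_
  rw [ht]
  field_simp
  ring

/-- The bilinear form of a matrix on Euclidean spaces. -/
noncomputable def euclideanBilin {m n : ℕ} (W : Matrix (Fin m) (Fin n) ℝ) :
    EuclideanSpace ℝ (Fin m) →ₗ[ℝ] EuclideanSpace ℝ (Fin n) →ₗ[ℝ] ℝ :=
  (innerₗ (EuclideanSpace ℝ (Fin m))).compl₂ (Matrix.toEuclideanLin W)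

theorem euclideanBilin_apply {m n : ℕ} (W : Matrix (Fin m) (Fin n) ℝ)
    (x : EuclideanSpace ℝ (Fin m)) (y : EuclideanSpace ℝ (Fin n)) :
    euclideanBilin W x y = inner ℝ x (Matrix.toEuclideanLin W y) := rfl

theorem euclideanBilin_eq_sum {m n : ℕ} (W : Matrix (Fin m) (Fin n) ℝ)
    (x : EuclideanSpace ℝ (Fin m)) (y : EuclideanSpace ℝ (Fin n)) :
    euclideanBilin W x y = ∑ p : Fin m × Fin n, x p.1 * y p.2 * W p.1 p.2 := by
  rw [euclideanBilin_apply, PiLp.inner_apply, Fintype.sum_prod_type]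
  refine Finset.sum_congr rfl fun u _ => ?_
  simp only [Matrix.toLpLin_apply, Matrix.mulVec, dotProduct, RCLike.inner_apply, conj_trivial,
    Finset.sum_mul]
  exact Finset.sum_congr rfl fun i _ => by ring

section Random

variable {Ω : Type*} [MeasurableSpace Ω] {μ : Measure Ω} [IsProbabilityMeasure μ] {m n : ℕ}
  {Xstar P : Matrix (Fin m) (Fin n) ℝ} {X : Ω → Matrix (Fin m) (Fin n) (Option ℝ)}

theorem IsPartialObservation.hoeffding (hX : IsPartialObservation μ Xstar P X)
    (hP : ∀ u i, 0 ≤ P u i) (w : Fin m × Fin n → ℝ) {V ε : ℝ} (hV : ∑ p, w p ^ 2 ≤ V)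
    (hV0 : 0 < V) (hε : 0 ≤ ε) :
    μ.real {ω | ε ≤ ∑ p, w p * (mask (X ω) - P) p.1 p.2} ≤ Real.exp (-2 * ε ^ 2 / V) := by
  convert! hoeffding_indicator (S := fun p : Fin m × Fin n => {ω | (X ω p.1 p.2).isSome})
    (fun p => hX.measurableSet_revealed p.1 p.2) hX.indep w hV hV0 hε using 6 with ω p _
  rw [Matrix.sub_apply, measureReal_def, hX.prob_revealed, ENNReal.toReal_ofReal (hP _ _)]
  simp [mask, Set.indicator_apply]

theorem IsPartialObservation.hoeffding_abs (hX : IsPartialObservation μ Xstar P X)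
    (hP : ∀ u i, 0 ≤ P u i) (w : Fin m × Fin n → ℝ) {V ε : ℝ} (hV : ∑ p, w p ^ 2 ≤ V)
    (hV0 : 0 < V) (hε : 0 ≤ ε) :
    μ.real {ω | ε ≤ |∑ p, w p * (mask (X ω) - P) p.1 p.2|}
      ≤ 2 * Real.exp (-2 * ε ^ 2 / V) := by
  have h1 := hX.hoeffding hP w hV hV0 hε
  have h2 := hX.hoeffding hP (fun p => -w p) (by simpa using hV) hV0 hε
  have hsub : {ω | ε ≤ |∑ p, w p * (mask (X ω) - P) p.1 p.2|} ⊆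
      {ω | ε ≤ ∑ p, w p * (mask (X ω) - P) p.1 p.2} ∪
      {ω | ε ≤ ∑ p, (fun p => -w p) p * (mask (X ω) - P) p.1 p.2} := by
    intro ω hω
    rcases le_abs.1 (Set.mem_ofPred.1 hω) with h | h
    · exact Or.inl h
    · exact Or.inr (by simpa using h)
  have := (measureReal_mono hsub (μ := μ)).trans (measureReal_union_le _ _)
  linarith

/-- The centred mask has operator norm at most `4 t` with high probability. -/
theorem IsPartialObservation.measureReal_exists_lt_bilin (hX : IsPartialObservation μ Xstar P X)
    (hP : ∀ u i, 0 ≤ P u i) {t : ℝ} (ht : 0 ≤ t) :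
    μ.real {ω | ∃ x y, 4 * t * ‖x‖ * ‖y‖ < euclideanBilin (mask (X ω) - P) x y}
      ≤ 5 ^ (m + n) * Real.exp (-2 * t ^ 2) := by
  obtain ⟨s, hs, hs1, hsnet⟩ := exists_half_net (EuclideanSpace ℝ (Fin m))
  obtain ⟨s', hs', hs1', hsnet'⟩ := exists_half_net (EuclideanSpace ℝ (Fin n))
  rw [finrank_euclideanSpace_fin] at hs hs'
  have hsub : {ω | ∃ x y, 4 * t * ‖x‖ * ‖y‖ < euclideanBilin (mask (X ω) - P) x y} ⊆
      ⋃ q ∈ s ×ˢ s', {ω | t ≤ ∑ p : Fin m × Fin n,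
        (fun p => q.1 p.1 * q.2 p.2) p * (mask (X ω) - P) p.1 p.2} := by
    rintro ω ⟨x, y, hxy⟩
    by_contra hcon
    simp only [Set.mem_iUnion, not_exists, Set.mem_ofPred_eq, not_le] at hcon
    refine absurd hxy (not_lt.2 (bilin_le_of_half_net hsnet hsnet' _ (fun c hc d hd => ?_) x y))
    rw [euclideanBilin_eq_sum]
    exact (hcon (c, d) (Finset.mk_mem_product hc hd)).le
  have hone : ∀ q ∈ s ×ˢ s', μ.real {ω | t ≤ ∑ p : Fin m × Fin n,
        (fun p => q.1 p.1 * q.2 p.2) p * (mask (X ω) - P) p.1 p.2} ≤ Real.exp (-2 * t ^ 2) := by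
    intro q hq
    obtain ⟨hq1, hq2⟩ := Finset.mem_product.1 hq
    -- The weights form a rank-one matrix, whose squared Frobenius norm is the product of the
    -- squared norms.
    have hV : ∑ p : Fin m × Fin n, (fun p => q.1 p.1 * q.2 p.2) p ^ 2 ≤ (1 : ℝ) := by
      have : ∑ p : Fin m × Fin n, (fun p => q.1 p.1 * q.2 p.2) p ^ 2
          = ‖q.1‖ ^ 2 * ‖q.2‖ ^ 2 := by
        rw [EuclideanSpace.real_norm_sq_eq, EuclideanSpace.real_norm_sq_eq,
          Finset.sum_mul_sum, Fintype.sum_prod_type]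
        simp only [mul_pow]
      rw [this]
      exact mul_le_one₀ (pow_le_one₀ (norm_nonneg _) (hs1 _ hq1)) (by positivity)
        (pow_le_one₀ (norm_nonneg _) (hs1' _ hq2))
    simpa using hX.hoeffding hP (fun p => q.1 p.1 * q.2 p.2) hV one_pos ht
  calc _ ≤ _ := measureReal_mono hsub (measure_ne_top _ _)
    _ ≤ _ := measureReal_biUnion_finset_le _ _
    _ ≤ ∑ _q ∈ s ×ˢ s', Real.exp (-2 * t ^ 2) := Finset.sum_le_sum hone
    _ = ((s.card * s'.card : ℕ) : ℝ) * Real.exp (-2 * t ^ 2) := by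
      rw [Finset.sum_const, Finset.card_product, nsmul_eq_mul]
    _ ≤ _ := by
      gcongr
      rw [pow_add]
      exact_mod_cast Nat.mul_le_mul hs hs'

/-- The exponent beats the size of the net: with N = m + n, e ≥ 2 gives (e(√m + √n))² ≥ 4N, while 5
≤ e⁴, so the product is at most exp(-4N). -/
theorem five_pow_mul_exp_le {m n : ℕ} (hm : 0 < m) :
    (5 : ℝ) ^ (m + n) * Real.exp (-2 * (Real.exp 1 * (√m + √n)) ^ 2) ≤ 1 / ((m : ℝ) + n) := by
  have hm' : (0 : ℝ) < m := by exact_mod_cast hm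
  have hn : (0 : ℝ) ≤ n := n.cast_nonneg
  have hN : (0 : ℝ) < (m : ℝ) + n := by linarith
  have he : 2 ≤ Real.exp 1 := by linarith [Real.add_one_le_exp 1]
  have h5 : (5 : ℝ) ≤ Real.exp 4 := by linarith [Real.add_one_le_exp 4]
  have h1 : (m : ℝ) + n ≤ (√m + √n) ^ 2 := by
    nlinarith [Real.sq_sqrt hm'.le, Real.sq_sqrt hn, Real.sqrt_nonneg (m : ℝ),
      Real.sqrt_nonneg (n : ℝ), mul_nonneg (Real.sqrt_nonneg (m : ℝ)) (Real.sqrt_nonneg (n : ℝ))]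
  have h2 : 4 * ((m : ℝ) + n) ≤ (Real.exp 1 * (√m + √n)) ^ 2 := by
    rw [mul_pow]
    have : (2 : ℝ) ^ 2 ≤ Real.exp 1 ^ 2 := pow_le_pow_left₀ (by norm_num) he 2
    nlinarith
  have h3 : (5 : ℝ) ^ (m + n) ≤ Real.exp (4 * ((m : ℝ) + n)) := by
    refine (pow_le_pow_left₀ (by norm_num) h5 _).trans_eq ?_
    rw [← Real.exp_nat_mul]
    push_cast
    ring_nf
  calc _ ≤ Real.exp (4 * ((m : ℝ) + n)) * Real.exp (-8 * ((m : ℝ) + n)) := by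
        refine mul_le_mul h3 (Real.exp_le_exp.2 ?_) (Real.exp_pos _).le (Real.exp_pos _).le
        linarith
    _ = Real.exp (-(4 * ((m : ℝ) + n))) := by rw [← Real.exp_add]; ring_nf
    _ ≤ 1 / ((m : ℝ) + n) := by
      rw [Real.exp_neg, ← one_div]
      gcongr
      linarith [Real.add_one_le_exp (4 * ((m : ℝ) + n))]

end Random

/-! ### Deterministic error bounds -/

theorem abs_apply_le_maxNorm {m n : ℕ} (A : Matrix (Fin m) (Fin n) ℝ) (u : Fin m) (i : Fin n) :
    |A u i| ≤ maxNorm A :=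
  le_ciSup (f := fun p : Fin m × Fin n => |A p.1 p.2|) (Set.finite_range _).bddAbove (u, i)

theorem sigmoid_neg_le_sigmoid_of_maxNorm_le {m n : ℕ} {A : Matrix (Fin m) (Fin n) ℝ} {α : ℝ}
    (hA : maxNorm A ≤ α) (u : Fin m) (i : Fin n) : Real.sigmoid (-α) ≤ Real.sigmoid (A u i) :=
  Real.sigmoid_le (abs_le.1 ((abs_apply_le_maxNorm A u i).trans hA)).1

/-- The likelihood-ratio identity behind the consistency of 1bitMC. -/
theorem sum_sq_sigmoid_sub_le {m n : ℕ} (M A B : Matrix (Fin m) (Fin n) ℝ)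
    (h : logLikelihood M A ≤ logLikelihood M B) :
    2 * ∑ u, ∑ i, (Real.sigmoid (B u i) - Real.sigmoid (A u i)) ^ 2 ≤
      ∑ u, ∑ i, (M - A.map Real.sigmoid) u i * B u i
        + ∑ u, ∑ i, (A.map Real.sigmoid - M) u i * A u i := by
  have key : ∀ u i, 2 * (Real.sigmoid (B u i) - Real.sigmoid (A u i)) ^ 2 +
      ((M u i * Real.log (Real.sigmoid (B u i))
        + (1 - M u i) * Real.log (1 - Real.sigmoid (B u i)))
      - (M u i * Real.log (Real.sigmoid (A u i))
        + (1 - M u i) * Real.log (1 - Real.sigmoid (A u i)))) ≤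
      (M - A.map Real.sigmoid) u i * B u i + (A.map Real.sigmoid - M) u i * A u i := by
    intro u i
    have h1 := two_mul_sq_sigmoid_sub_le (A u i) (B u i)
    have h2 := log_sigmoid_sub (A u i)
    have h3 := log_sigmoid_sub (B u i)
    simp only [Matrix.sub_apply, Matrix.map_apply]
    -- With log σ(x) = x + log(1 - σ(x)), each likelihood term becomes M x + log(1 - σ(x)), and the
    -- logarithms cancel against those in Pinsker's inequality.
    generalize Real.log (1 - Real.sigmoid (A u i)) = q at *
    generalize Real.log (1 - Real.sigmoid (B u i)) = r at *
    generalize Real.log (Real.sigmoid (A u i)) = q' at *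
    generalize Real.log (Real.sigmoid (B u i)) = r' at *
    obtain rfl : q' = A u i + q := by linarith
    obtain rfl : r' = B u i + r := by linarith
    linarith
  have hsum := Finset.sum_le_sum fun u (_ : u ∈ Finset.univ) =>
    Finset.sum_le_sum fun i (_ : i ∈ Finset.univ) => key u i
  simp only [Finset.sum_add_distrib, Finset.sum_sub_distrib, ← Finset.mul_sum] at hsum
  simp only [logLikelihood, Finset.sum_add_distrib] at h
  linarith

/-- Deterministic error bound for 1bitMC in terms of the operator norm of the noise. -/
theorem IsOutput.mse_le {m n : ℕ} (hm : 0 < m) (hn : 0 < n) {θ α τ γ t : ℝ} (hθτ : θ ≤ τ)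
    (hαγ : α ≤ γ) (ht : 0 ≤ t) {A M Phat : Matrix (Fin m) (Fin n) ℝ}
    (hA : nuclearNorm A ≤ θ * √((m : ℝ) * n)) (hAmax : maxNorm A ≤ α)
    (hout : IsOutput τ γ M Phat)
    (hop : ∀ x y, euclideanBilin (M - A.map Real.sigmoid) x y ≤ t * ‖x‖ * ‖y‖) :
    mse Phat (A.map Real.sigmoid) ≤ t * τ / √((m : ℝ) * n) := by
  obtain ⟨B, ⟨hB, -⟩, hmax, rfl⟩ := hout
  have hmn : (0 : ℝ) < (m : ℝ) * n := by positivity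
  have hA' : nuclearNorm A ≤ τ * √((m : ℝ) * n) := hA.trans (by gcongr)
  have hlik : logLikelihood M A ≤ logLikelihood M B := hmax ⟨hA', hAmax.trans hαγ⟩
  have h1 := sum_mul_le_mul_nuclearNorm (M - A.map Real.sigmoid) B hop
  have h2 := sum_mul_le_mul_nuclearNorm (A.map Real.sigmoid - M) A (c := t) fun x y => by
    have := hop (-x) y
    rw [norm_neg, euclideanBilin_apply, inner_neg_left, ← inner_neg_right,
      ← LinearMap.neg_apply, ← map_neg, neg_sub] at this
    exact this
  have h3 := sum_sq_sigmoid_sub_le M A B hlik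
  have h4 : t * nuclearNorm B ≤ t * (τ * √((m : ℝ) * n)) := by gcongr
  have h5 : t * nuclearNorm A ≤ t * (τ * √((m : ℝ) * n)) := by gcongr
  have h6 : ∑ u, ∑ i, (Real.sigmoid (B u i) - Real.sigmoid (A u i)) ^ 2
      ≤ t * (τ * √((m : ℝ) * n)) := by linarith
  have hs : √((m : ℝ) * n) * √((m : ℝ) * n) = (m : ℝ) * n := Real.mul_self_sqrt hmn.le
  have hs0 : 0 < √((m : ℝ) * n) := Real.sqrt_pos.2 hmn
  calc mse (B.map Real.sigmoid) (A.map Real.sigmoid)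
      ≤ 1 / ((m : ℝ) * n) * (t * (τ * √((m : ℝ) * n))) := by
        unfold mse
        gcongr
        simpa using h6
    _ = t * τ / √((m : ℝ) * n) := by
      generalize √((m : ℝ) * n) = r at hs hs0
      rw [← hs]
      field_simp

theorem sum_abs_le_sqrt {ι : Type*} [Fintype ι] (f : ι → ℝ) :
    ∑ i, |f i| ≤ √(Fintype.card ι * ∑ i, f i ^ 2) := by
  refine Real.le_sqrt_of_sq_le ?_
  simpa using sq_sum_le_card_mul_sum_sq (s := Finset.univ) (f := fun i => |f i|)

/-- Bias-variance style decomposition of an inverse-propensity-scored sum. -/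
theorem abs_sum_ips_sub_le {ι : Type*} [Fintype ι] {M P Q l : ι → ℝ} {a b K : ℝ} (ha : 0 < a)
    (hb : 0 < b) (hM : ∀ i, M i ∈ Set.Icc (0 : ℝ) 1) (hP : ∀ i, a ≤ P i) (hQ : ∀ i, b ≤ Q i)
    (hl0 : ∀ i, 0 ≤ l i) (hlK : ∀ i, l i ≤ K) :
    |∑ i, M i * (l i / Q i) - ∑ i, l i| ≤
      K / (b * a) * ∑ i, |Q i - P i| + |∑ i, l i / P i * (M i - P i)| := by
  -- Only the first sum involves Q, which may depend on M; the second is centred when P is the mean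
  -- of M.
  have hdec : ∑ i, M i * (l i / Q i) - ∑ i, l i =
      ∑ i, M i * l i * (P i - Q i) / (Q i * P i) + ∑ i, l i / P i * (M i - P i) := by
    rw [← Finset.sum_sub_distrib, ← Finset.sum_add_distrib]
    refine Finset.sum_congr rfl fun i _ => ?_
    have := (ha.trans_le (hP i)).ne'
    have := (hb.trans_le (hQ i)).ne'
    field_simp
    ring
  rw [hdec]
  refine (abs_add_le _ _).trans (add_le_add ?_ le_rfl)
  rw [Finset.mul_sum]
  refine (Finset.abs_sum_le_sum_abs _ _).trans (Finset.sum_le_sum fun i _ => ?_)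
  have hP0 := ha.trans_le (hP i)
  have hQ0 := hb.trans_le (hQ i)
  have hK : M i * l i ≤ K :=
    (mul_le_of_le_one_left (hl0 i) (hM i).2).trans (hlK i)
  rw [abs_div, abs_mul, abs_of_nonneg (mul_nonneg (hM i).1 (hl0 i)), abs_of_pos (mul_pos hQ0 hP0),
    abs_sub_comm, div_mul_eq_mul_div]
  have := (mul_nonneg (hM i).1 (hl0 i)).trans hK
  gcongr
  · exact hQ i
  · exact hP i

theorem sqrt_add_sqrt_div_sqrt_mul {x y : ℝ} (hx : 0 < x) (hy : 0 < y) :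
    (√x + √y) / √(x * y) = 1 / √x + 1 / √y := by
  have := Real.sqrt_pos.2 hx
  have := Real.sqrt_pos.2 hy
  rw [Real.sqrt_mul hx.le]
  field_simp
  ring

/-- Subadditivity of the square root, the source of the exponents 1/4. -/
theorem sqrt_one_div_sqrt_add_le {x y : ℝ} (hx : 0 < x) (hy : 0 < y) :
    √(1 / √x + 1 / √y) ≤ 1 / x ^ (1 / 4 : ℝ) + 1 / y ^ (1 / 4 : ℝ) := by
  have h : ∀ z : ℝ, 0 < z → 1 / √z = (1 / z ^ (1 / 4 : ℝ)) ^ 2 := by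
    intro z hz
    rw [div_pow, one_pow, ← Real.rpow_mul_natCast hz.le, Real.sqrt_eq_rpow]
    norm_num
  have hx' : 0 < 1 / x ^ (1 / 4 : ℝ) := by positivity
  have hy' : 0 < 1 / y ^ (1 / 4 : ℝ) := by positivity
  rw [h x hx, h y hy]
  refine Real.sqrt_le_iff.2 ⟨by positivity, ?_⟩
  nlinarith [mul_pos hx' hy']

theorem sum_revealed_eq {m n : ℕ} (X : Matrix (Fin m) (Fin n) (Option ℝ))
    (f : Fin m × Fin n → ℝ) :
    ∑ p ∈ revealed X, f p = ∑ p : Fin m × Fin n, mask X p.1 p.2 * f p := by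
  rw [revealed, Finset.sum_filter]
  refine Finset.sum_congr rfl fun p _ => ?_
  simp [mask]

theorem mask_mem_Icc {m n : ℕ} (X : Matrix (Fin m) (Fin n) (Option ℝ)) (u : Fin m) (i : Fin n) :
    mask X u i ∈ Set.Icc (0 : ℝ) 1 := by
  simp only [mask, Matrix.of_apply]
  split_ifs <;> simp

/-- Deterministic error bound for inverse-propensity-scored losses. -/
theorem abs_ips_sub_le {m n : ℕ} (hm : 0 < m) (hn : 0 < n)
    (X : Matrix (Fin m) (Fin n) (Option ℝ)) {P Q : Matrix (Fin m) (Fin n) ℝ}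
    {l : Fin m × Fin n → ℝ} {a b K ε η : ℝ} (ha : 0 < a) (hb : 0 < b) (hK : 0 ≤ K)
    (hP : ∀ u i, a ≤ P u i) (hQ : ∀ u i, b ≤ Q u i) (hl0 : ∀ p, 0 ≤ l p) (hlK : ∀ p, l p ≤ K)
    (hε : mse Q P ≤ ε)
    (hη : |∑ p, l p / P p.1 p.2 * (mask X - P) p.1 p.2| ≤ (m : ℝ) * n * η) :
    |1 / ((m : ℝ) * n) * ∑ p ∈ revealed X, l p / Q p.1 p.2 - 1 / ((m : ℝ) * n) * ∑ p, l p| ≤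
      K / (b * a) * √ε + η := by
  have hN : (0 : ℝ) < (m : ℝ) * n := by positivity
  have h1 := abs_sum_ips_sub_le (M := fun p : Fin m × Fin n => mask X p.1 p.2)
    (P := fun p => P p.1 p.2) (Q := fun p => Q p.1 p.2) ha hb
    (fun p => mask_mem_Icc X p.1 p.2) (fun p => hP p.1 p.2) (fun p => hQ p.1 p.2) hl0 hlK
  -- Cauchy–Schwarz passes from the squared error to the absolute error, at the cost of a square
  -- root.
  have h2 : ∑ p : Fin m × Fin n, |Q p.1 p.2 - P p.1 p.2| ≤ (m : ℝ) * n * √ε := by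
    refine (sum_abs_le_sqrt _).trans ?_
    have hcard : (Fintype.card (Fin m × Fin n) : ℝ) = (m : ℝ) * n := by simp
    have hsum : ∑ p : Fin m × Fin n, (Q p.1 p.2 - P p.1 p.2) ^ 2 = (m : ℝ) * n * mse Q P := by
      rw [mse, Fintype.sum_prod_type]
      field_simp
    rw [hcard, hsum, ← mul_assoc, Real.sqrt_mul (by positivity), Real.sqrt_mul_self hN.le]
    gcongr
  have hKab : 0 ≤ K / (b * a) := by positivity
  have h3 : K / (b * a) * ∑ p : Fin m × Fin n, |Q p.1 p.2 - P p.1 p.2| ≤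
      K / (b * a) * ((m : ℝ) * n * √ε) := by gcongr
  rw [sum_revealed_eq, ← mul_sub, abs_mul, abs_of_pos (by positivity)]
  simp only [Matrix.sub_apply] at hη
  calc _ ≤ 1 / ((m : ℝ) * n) * (K / (b * a) * ((m : ℝ) * n * √ε) + (m : ℝ) * n * η) := by
        gcongr
        linarith
    _ = _ := by field_simp

/-! ### High-probability bounds -/

section Random

variable {Ω : Type*} [MeasurableSpace Ω] {μ : Measure Ω} [IsProbabilityMeasure μ] {m n : ℕ}
  {Xstar P : Matrix (Fin m) (Fin n) ℝ} {X : Ω → Matrix (Fin m) (Fin n) (Option ℝ)}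

/-- The weights l/P lie in [0, K/a], so their squares sum to at most mn(K/a)². The threshold makes
each Hoeffding tail δ/2. -/
theorem IsPartialObservation.measureReal_ips_deviation_le (hX : IsPartialObservation μ Xstar P X)
    (hm : 0 < m) (hn : 0 < n) {l : Fin m × Fin n → ℝ} {a K δ : ℝ} (ha : 0 < a) (hK : 0 < K)
    (hP : ∀ u i, a ≤ P u i) (hl0 : ∀ p, 0 ≤ l p) (hlK : ∀ p, l p ≤ K) (hδ : 0 < δ)
    (hδ1 : δ < 1) :
    μ.real {ω | (m : ℝ) * n * (K / a * √(1 / (2 * (m : ℝ) * n) * Real.log (2 / δ)))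
      ≤ |∑ p, l p / P p.1 p.2 * (mask (X ω) - P) p.1 p.2|} ≤ δ := by
  have hm' : (0 : ℝ) < m := by exact_mod_cast hm
  have hn' : (0 : ℝ) < n := by exact_mod_cast hn
  have hlog : 0 ≤ Real.log (2 / δ) := Real.log_nonneg (by rw [le_div_iff₀ hδ]; linarith)
  have hV : ∑ p : Fin m × Fin n, (l p / P p.1 p.2) ^ 2 ≤ (m : ℝ) * n * (K / a) ^ 2 := by
    calc _ ≤ ∑ _p : Fin m × Fin n, (K / a) ^ 2 := by
          refine Finset.sum_le_sum fun p _ => ?_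
          have := hl0 p
          have := hlK p
          have := hP p.1 p.2
          have : 0 < P p.1 p.2 := by linarith
          gcongr
      _ = _ := by simp
  refine (hX.hoeffding_abs (fun u i => ha.le.trans (hP u i)) (fun p => l p / P p.1 p.2) hV
    (by positivity) (by positivity)).trans_eq ?_
  have hexp : -2 * ((m : ℝ) * n * (K / a * √(1 / (2 * (m : ℝ) * n) * Real.log (2 / δ)))) ^ 2
      / ((m : ℝ) * n * (K / a) ^ 2) = -Real.log (2 / δ) := by
    have hsq := Real.sq_sqrt (by positivity : 0 ≤ 1 / (2 * (m : ℝ) * n) * Real.log (2 / δ))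
    rw [mul_pow, mul_pow (K / a), hsq]
    field_simp
  rw [hexp, Real.exp_neg, Real.exp_log (by positivity)]
  field_simp

/-- High-probability bounds for 1bitMC propensities and for the inverse-propensity-scored version
of an average of entrywise losses in `[0, K]`. -/
theorem IsPartialObservation.le_measureReal_ips_bound {A : Matrix (Fin m) (Fin n) ℝ}
    (hX : IsPartialObservation μ Xstar (A.map Real.sigmoid) X)
    (hm : 0 < m) (hn : 0 < n) {θ α τ γ δ : ℝ} (hθ : 0 < θ) (hθτ : θ ≤ τ) (hαγ : α ≤ γ)
    (hδ : 0 < δ) (hδ1 : δ < 1) (hA : nuclearNorm A ≤ θ * √((m : ℝ) * n)) (hAmax : maxNorm A ≤ α)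
    {Phat : Ω → Matrix (Fin m) (Fin n) ℝ} (hout : ∀ ω, IsOutput τ γ (mask (X ω)) (Phat ω))
    {l : Fin m × Fin n → ℝ} {K : ℝ} (hK : 0 < K) (hl0 : ∀ p, 0 ≤ l p) (hlK : ∀ p, l p ≤ K) :
    1 - 1 / ((m : ℝ) + n) - δ ≤ μ.real {ω |
      mse (Phat ω) (A.map Real.sigmoid) ≤ 4 * Real.exp 1 * τ * (1 / √(m : ℝ) + 1 / √(n : ℝ)) ∧
      |1 / ((m : ℝ) * n) * ∑ p ∈ revealed (X ω), l p / Phat ω p.1 p.2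
          - 1 / ((m : ℝ) * n) * ∑ p, l p| ≤
        2 * K * √(Real.exp 1 * τ) / (Real.sigmoid (-γ) * Real.sigmoid (-α))
            * (1 / (m : ℝ) ^ (1 / 4 : ℝ) + 1 / (n : ℝ) ^ (1 / 4 : ℝ))
          + K / Real.sigmoid (-α) * √(1 / (2 * (m : ℝ) * n) * Real.log (2 / δ))} := by
  have hm' : (0 : ℝ) < m := by exact_mod_cast hm
  have hn' : (0 : ℝ) < n := by exact_mod_cast hn
  have hτ : 0 < τ := hθ.trans_le hθτ
  have ha := Real.sigmoid_pos (-α)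
  have hb := Real.sigmoid_pos (-γ)
  have hP : ∀ u i, Real.sigmoid (-α) ≤ A.map Real.sigmoid u i :=
    sigmoid_neg_le_sigmoid_of_maxNorm_le hAmax
  set t := Real.exp 1 * (√(m : ℝ) + √(n : ℝ)) with ht
  have ht0 : 0 ≤ t := by positivity
  have hbad1 := (hX.measureReal_exists_lt_bilin (fun u i => ha.le.trans (hP u i)) ht0).trans
    (five_pow_mul_exp_le hm)
  have hbad2 := hX.measureReal_ips_deviation_le hm hn ha hK hP hl0 hlK hδ hδ1
  set bad1 := {ω | ∃ x y,
    4 * t * ‖x‖ * ‖y‖ < euclideanBilin (mask (X ω) - A.map Real.sigmoid) x y}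
  set η := K / Real.sigmoid (-α) * √(1 / (2 * (m : ℝ) * n) * Real.log (2 / δ))
  set bad2 := {ω | (m : ℝ) * n * η ≤ |∑ p, l p / A.map Real.sigmoid p.1 p.2
    * (mask (X ω) - A.map Real.sigmoid) p.1 p.2|}
  set good := {ω | _ ∧ _}
  -- Covering the whole space and using subadditivity avoids any measurability of the good event, as
  -- `Phat` is an arbitrary choice of maximizers.
  suffices hcover : Set.univ ⊆ good ∪ (bad1 ∪ bad2) by
    have h1 := measureReal_mono (μ := μ) hcover
    rw [probReal_univ] at h1
    have h2 := measureReal_union_le (μ := μ) good (bad1 ∪ bad2)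
    have h3 := measureReal_union_le (μ := μ) bad1 bad2
    linarith
  intro ω _
  by_cases h1 : ω ∈ bad1
  · exact Or.inr (Or.inl h1)
  by_cases h2 : ω ∈ bad2
  · exact Or.inr (Or.inr h2)
  left
  simp only [bad1, bad2, Set.mem_ofPred_eq, not_exists, not_lt, not_le] at h1 h2
  have hmse : mse (Phat ω) (A.map Real.sigmoid)
      ≤ 4 * Real.exp 1 * τ * (1 / √(m : ℝ) + 1 / √(n : ℝ)) := by
    refine ((hout ω).mse_le hm hn hθτ hαγ (by positivity) hA hAmax h1).trans_eq ?_
    rw [← sqrt_add_sqrt_div_sqrt_mul hm' hn', ht]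
    ring
  have hQ : ∀ u i, Real.sigmoid (-γ) ≤ Phat ω u i := by
    obtain ⟨B, hB, -, hPB⟩ := hout ω
    rw [hPB]
    exact sigmoid_neg_le_sigmoid_of_maxNorm_le hB.2
  refine ⟨hmse, (abs_ips_sub_le hm hn (X ω) ha hb hK.le hP hQ hl0 hlK hmse h2.le).trans ?_⟩
  gcongr ?_ + _
  have hsqrt : √(4 * Real.exp 1 * τ * (1 / √(m : ℝ) + 1 / √(n : ℝ)))
      = 2 * √(Real.exp 1 * τ) * √(1 / √(m : ℝ) + 1 / √(n : ℝ)) := by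
    rw [mul_assoc 4, Real.sqrt_mul (by positivity), Real.sqrt_mul (by positivity),
      show (4 : ℝ) = 2 ^ 2 by norm_num, Real.sqrt_sq (by norm_num)]
  rw [hsqrt]
  calc _ ≤ K / (Real.sigmoid (-γ) * Real.sigmoid (-α)) * (2 * √(Real.exp 1 * τ)
        * (1 / (m : ℝ) ^ (1 / 4 : ℝ) + 1 / (n : ℝ) ^ (1 / 4 : ℝ))) := by
        gcongr
        exact sqrt_one_div_sqrt_add_le hm' hn'
    _ = _ := by ring

end Random

/-! ### Specialization to squared and absolute losses -/

theorem IsPartialObservation.getD_eq {Ω : Type*} [MeasurableSpace Ω] {μ : Measure Ω} {m n : ℕ}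
    {Xstar P : Matrix (Fin m) (Fin n) ℝ} {X : Ω → Matrix (Fin m) (Fin n) (Option ℝ)}
    (hX : IsPartialObservation μ Xstar P X) (ω : Ω) {p : Fin m × Fin n}
    (hp : p ∈ revealed (X ω)) : (X ω p.1 p.2).getD 0 = Xstar p.1 p.2 := by
  simp only [revealed, Finset.mem_filter, Finset.mem_univ, true_and] at hp
  rcases hX.eq_some_or_none ω p.1 p.2 with h | h
  · rw [h, Option.getD_some]
  · simp [h] at hp

theorem IsPartialObservation.ipsMSE_eq {Ω : Type*} [MeasurableSpace Ω] {μ : Measure Ω} {m n : ℕ}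
    {Xstar P : Matrix (Fin m) (Fin n) ℝ} {X : Ω → Matrix (Fin m) (Fin n) (Option ℝ)}
    (hX : IsPartialObservation μ Xstar P X) (ω : Ω) (S Q : Matrix (Fin m) (Fin n) ℝ) :
    ipsMSE (X ω) S Q = 1 / ((m : ℝ) * n) *
      ∑ p ∈ revealed (X ω), (S p.1 p.2 - Xstar p.1 p.2) ^ 2 / Q p.1 p.2 := by
  unfold ipsMSE
  congr 1
  exact Finset.sum_congr rfl fun p hp => by rw [hX.getD_eq ω hp]

theorem IsPartialObservation.ipsMAE_eq {Ω : Type*} [MeasurableSpace Ω] {μ : Measure Ω} {m n : ℕ}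
    {Xstar P : Matrix (Fin m) (Fin n) ℝ} {X : Ω → Matrix (Fin m) (Fin n) (Option ℝ)}
    (hX : IsPartialObservation μ Xstar P X) (ω : Ω) (S Q : Matrix (Fin m) (Fin n) ℝ) :
    ipsMAE (X ω) S Q = 1 / ((m : ℝ) * n) *
      ∑ p ∈ revealed (X ω), |S p.1 p.2 - Xstar p.1 p.2| / Q p.1 p.2 := by
  unfold ipsMAE
  congr 1
  exact Finset.sum_congr rfl fun p hp => by rw [hX.getD_eq ω hp]

theorem abs_sub_le_of_maxNorm_le {m n : ℕ} {S T : Matrix (Fin m) (Fin n) ℝ} {ψ : ℝ}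
    (hS : maxNorm S ≤ ψ) (hT : maxNorm T ≤ ψ) (u : Fin m) (i : Fin n) :
    |S u i - T u i| ≤ 2 * ψ := by
  have h1 := abs_apply_le_maxNorm S u i
  have h2 := abs_apply_le_maxNorm T u i
  linarith [abs_sub (S u i) (T u i)]

end OneBitMC

theorem theorem1 :
    ∃ C : ℝ, 0 < C ∧
      ∀ (m n : ℕ), 0 < m → 0 < n → C ≤ (m : ℝ) + n →
      ∀ (θ α φ τ γ ψ δ : ℝ), 0 < θ → 0 < α → 0 < φ → θ ≤ τ → α ≤ γ → φ ≤ ψ →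
        0 < δ → δ < 1 →
      ∀ (A Xstar Shat : Matrix (Fin m) (Fin n) ℝ),
        OneBitMC.nuclearNorm A ≤ θ * √((m : ℝ) * n) → OneBitMC.maxNorm A ≤ α →
        OneBitMC.maxNorm Xstar ≤ φ → OneBitMC.maxNorm Shat ≤ ψ →
      ∀ (Ω : Type*) [MeasurableSpace Ω] (μ : MeasureTheory.Measure Ω) [MeasureTheory.IsProbabilityMeasure μ]
        (X : Ω → Matrix (Fin m) (Fin n) (Option ℝ)),
        OneBitMC.IsPartialObservation μ Xstar (A.map Real.sigmoid) X →
      ∀ (Phat : Ω → Matrix (Fin m) (Fin n) ℝ),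
        (∀ ω, OneBitMC.IsOutput τ γ (OneBitMC.mask (X ω)) (Phat ω)) →
      μ.real {ω |
          OneBitMC.mse (Phat ω) (A.map Real.sigmoid)
            ≤ 4 * Real.exp 1 * τ * (1 / √(m : ℝ) + 1 / √(n : ℝ)) ∧
          |OneBitMC.ipsMSE (X ω) Shat (Phat ω) - OneBitMC.mse Shat Xstar|
            ≤ 8 * ψ ^ 2 * √(Real.exp 1 * τ) / (Real.sigmoid (-γ) * Real.sigmoid (-α))
                * (1 / (m : ℝ) ^ (1 / 4 : ℝ) + 1 / (n : ℝ) ^ (1 / 4 : ℝ))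
              + 4 * ψ ^ 2 / Real.sigmoid (-α)
                * √(1 / (2 * (m : ℝ) * n) * Real.log (2 / δ))}
        ≥ 1 - C / ((m : ℝ) + n) - δ ∧
      μ.real {ω |
          OneBitMC.mse (Phat ω) (A.map Real.sigmoid)
            ≤ 4 * Real.exp 1 * τ * (1 / √(m : ℝ) + 1 / √(n : ℝ)) ∧
          |OneBitMC.ipsMAE (X ω) Shat (Phat ω) - OneBitMC.mae Shat Xstar|
            ≤ 4 * ψ * √(Real.exp 1 * τ) / (Real.sigmoid (-γ) * Real.sigmoid (-α))
                * (1 / (m : ℝ) ^ (1 / 4 : ℝ) + 1 / (n : ℝ) ^ (1 / 4 : ℝ))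
              + 2 * ψ / Real.sigmoid (-α)
                * √(1 / (2 * (m : ℝ) * n) * Real.log (2 / δ))}
        ≥ 1 - C / ((m : ℝ) + n) - δ := by
  -- C = 1 suffices, since the operator-norm event fails with probability at most 1/(m + n).
  refine ⟨1, one_pos, ?_⟩
  intro m n hm hn _ θ α φ τ γ ψ δ hθ _ hφ hθτ hαγ hφψ hδ hδ1 A Xstar Shat hA hAmax hXstar hShat
    Ω _ μ _ X hX Phat hout
  have hψ : 0 < ψ := hφ.trans_le hφψ
  have hdiff := OneBitMC.abs_sub_le_of_maxNorm_le hShat (hXstar.trans hφψ)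
  constructor
  · refine (hX.le_measureReal_ips_bound hm hn hθ hθτ hαγ hδ hδ1 hA hAmax hout
      (l := fun p => (Shat p.1 p.2 - Xstar p.1 p.2) ^ 2) (K := 4 * ψ ^ 2) (by positivity)
      (fun p => sq_nonneg _) (fun p => ?_)).trans (MeasureTheory.measureReal_mono ?_)
    · rw [← sq_abs]
      nlinarith [hdiff p.1 p.2, abs_nonneg (Shat p.1 p.2 - Xstar p.1 p.2)]
    · rintro ω ⟨h1, h2⟩
      refine ⟨h1, ?_⟩
      rw [hX.ipsMSE_eq, OneBitMC.mse, ← Fintype.sum_prod_type']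
      exact h2.trans_eq (by ring)
  · refine (hX.le_measureReal_ips_bound hm hn hθ hθτ hαγ hδ hδ1 hA hAmax hout
      (l := fun p => |Shat p.1 p.2 - Xstar p.1 p.2|) (K := 2 * ψ) (by positivity)
      (fun p => abs_nonneg _) (fun p => hdiff p.1 p.2)).trans (MeasureTheory.measureReal_mono ?_)
    rintro ω ⟨h1, h2⟩
    refine ⟨h1, ?_⟩
    rw [hX.ipsMAE_eq, OneBitMC.mae, ← Fintype.sum_prod_type']
    exact h2.trans_eq (by ring)
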